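/- All graphs are finite, undirected, without loops and parallel edges; a graph class is a set $\mathcal C$ of such graphs. **Definitions.** A graph $H$ is a *depth-$r$ minor* of $G$ if there are pairwise disjoint sets $B_w\subseteq V(G)$, for $w\in V(H)$, such that each $G[B_w]$ has a vertex $c_w$ at distance at most $r$ in $G[B_w]$ from every vertex of $B_w$, and for every edge $ww'$ of $H$ some edge of $G$ joins $B_w$ to $B_{w'}$. The class $\mathcal C$ has *bounded expansion* if for every $r\in\mathbb N$ there is $d\in\mathbb N$ such that $|E(H)|\le d\,|V(H)|$ for every depth-$r$ minor $H$ of every $G\in\mathcal C$. The class $\mathcal C$ is *weakly sparse* if there is $t\in\mathbb N$ such that no $G\in\mathcal C$ contains the biclique $K_{t,t}$ as a subgraph. For a partition $\mathcal P$ of $V(G)$, a *$\mathcal P$-flip* of $G$ is a graph obtained from $G$ by inverting the adjacency (of distinct vertices) between $A$ and $B$ for arbitrarily chosen unordered pairs of parts $A,B\in\mathcal P$ (possibly $A=B$). A *restrained flip sequence* for a graph $G$ with vertex set $V$ is a sequence $(\mathcal P_1,R_1,G_1),\dots,(\mathcal P_m,R_m,G_m)$, $m\ge 1$, such that - $\mathcal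 P_1,\dots,\mathcal P_m$ are partitions of $V$, each $\mathcal P_{i+1}$ refining $\mathcal P_i$, where $\mathcal P_1$ has a single part (no part if $V=\emptyset$) and $\mathcal P_m$ is the partition into singletons; - $G_i$ is a $\mathcal P_i$-flip of $G$ for every $i$; - $\binom V2=R_1\supseteq\dots\supseteq R_m=\emptyset$; - $E(G_i)\subseteq R_i$ for every $i$. For $r\in\mathbb N$, its *radius-$r$ width* is the maximum, over $1\le i<m$ and $v\in V$, of the number of parts $A\in\mathcal P_{i+1}$ for which the graph $(V,R_i)$ has a path of length at most $r$ from $v$ to a vertex of $A$ (a maximum over the empty set is $0$). The *radius-$r$ merge-width* $\operatorname{mw}_r(G)$ is the least radius-$r$ width of a restrained flip sequence for $G$. The class $\mathcal C$ has *bounded merge-width* if $\sup_{G\in\mathcal C}\operatorname{mw}_r(G)<\infty$ for every $r\in\mathbb N$. **Theorem.** A graph class has bounded expansion if and only if it is weakly sparse and has bounded merge-width. -/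

import Mathlib

universe u

/-- A finite simple graph (finite, undirected, without loops and parallel edges). -/
structure FinGraph where
  /-- the vertex set -/
  V : Type u
  /-- the vertex set is finite -/
  finite : Finite V
  /-- the adjacency relation -/
  graph : SimpleGraph V

/-- A graph class is a set of finite graphs. -/
abbrev GraphClass := Set FinGraph.{u}

namespace SparseGraphs

/-- `G` is `K_{t,t}`-free: no (not necessarily induced) subgraph of `G` is isomorphic to
the biclique with `t` vertices on each side. -/
def BicliqueFree {V : Type u} (t : ℕ) (G : SimpleGraph V) : Prop :=
  (completeBipartiteGraph (Fin t) (Fin t)).Free G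

/-- A class is weakly sparse if for some `t` all its graphs are `K_{t,t}`-free. -/
def WeaklySparse (C : GraphClass.{u}) : Prop :=
  ∃ t : ℕ, ∀ G ∈ C, BicliqueFree t G.graph

/-- `H` is a depth-`r` (shallow) minor of `G`: there are pairwise disjoint branch sets in `G`, one
for each vertex of `H`, each inducing a connected subgraph of radius at most `r`, such that
the branch sets of adjacent vertices of `H` are joined by an edge of `G`. -/
def IsShallowMinor {V : Type u} {W : Type*} (r : ℕ) (H : SimpleGraph W) (G : SimpleGraph V) :
    Prop :=
  ∃ B : W → Set V,
    (∀ w w', w ≠ w' → Disjoint (B w) (B w')) ∧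
    (∀ w, ∃ c : B w, ∀ x : B w, ∃ p : (G.induce (B w)).Walk c x, p.length ≤ r) ∧
    (∀ w w', H.Adj w w' → ∃ x ∈ B w, ∃ y ∈ B w', G.Adj x y)

/-- A class has bounded expansion if for every `r` the edge densities `|E(H)| / |V(H)|` of
the depth-`r` minors `H` of its graphs are bounded by a constant (depending on `r` only). Up to
isomorphism, the vertex set of the finite graph `H` is `Fin n`. -/
def BoundedExpansion (C : GraphClass.{u}) : Prop :=
  ∀ r : ℕ, ∃ d : ℕ, ∀ G ∈ C, ∀ (n : ℕ) (H : SimpleGraph (Fin n)),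
    IsShallowMinor r H G.graph → H.edgeSet.ncard ≤ d * n

/-- `H` is a `P`-flip of `G`, for a partition `P` of the vertices (given as an equivalence relation,
whose classes are the parts): `H` arises from `G` by inverting the adjacency between
the parts in each pair of a set `F` of unordered pairs of (possibly equal) parts. -/
def IsFlip {V : Type u} (P : Setoid V) (G H : SimpleGraph V) : Prop :=
  ∃ F : Set (Sym2 (Quotient P)), ∀ u v : V, u ≠ v →
    (H.Adj u v ↔ Xor (G.Adj u v) (s(Quotient.mk P u, Quotient.mk P v) ∈ F))

/-- A restrained flip sequence for `G`, with `m + 1` entries `(P i, R i, G i)`. Partitions are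
equivalence relations: `⊤` is the partition with a single part, `⊥` the partition into
singletons, and finer partitions are smaller. A set `R i` of unordered pairs of distinct vertices
is the same thing as the simple graph with that edge set: `⊤` contains all pairs, `⊥` is empty. -/
structure RestrainedFlipSeq {V : Type u} (G : SimpleGraph V) where
  /-- the number of entries minus one -/
  m : ℕ
  /-- the partitions -/
  P : Fin (m + 1) → Setoid V
  /-- the sets of pairs -/
  R : Fin (m + 1) → SimpleGraph V
  /-- the flips -/
  flip : Fin (m + 1) → SimpleGraph V
  P_antitone : Antitone P
  P_zero : P 0 = ⊤
  P_last : P (Fin.last m) = ⊥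
  isFlip : ∀ i, IsFlip (P i) G (flip i)
  R_antitone : Antitone R
  R_zero : R 0 = ⊤
  R_last : R (Fin.last m) = ⊥
  flip_le : ∀ i, flip i ≤ R i

/-- The set of parts of `P` that contain a vertex reachable from `v` by a path of length
at most `r` in the graph `R`. -/
def reachableParts {V : Type u} (r : ℕ) (P : Setoid V) (R : SimpleGraph V) (v : V) :
    Set (Quotient P) :=
  {A | ∃ u : V, Quotient.mk P u = A ∧ ∃ p : R.Walk v u, p.IsPath ∧ p.length ≤ r}

/-- The radius-`r` width of `(P, R)`: the maximum over all vertices `v` of the number of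
parts that are `r`-reachable from `v`. -/
noncomputable def radiusWidth {V : Type u} (r : ℕ) (P : Setoid V) (R : SimpleGraph V) : ℕ∞ :=
  ⨆ v : V, (reachableParts r P R v).encard

/-- The radius-`r` width of a restrained flip sequence: the maximum of the radius-`r` widths of
the pairs `(P (i + 1), R i)`. -/
noncomputable def RestrainedFlipSeq.width {V : Type u} {G : SimpleGraph V}
    (S : RestrainedFlipSeq G) (r : ℕ) : ℕ∞ :=
  ⨆ i : Fin S.m, radiusWidth r (S.P i.succ) (S.R i.castSucc)

/-- The radius-`r` merge-width of `G`: the least radius-`r` width of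
a restrained flip sequence for `G`. -/
noncomputable def mergeWidth {V : Type u} (r : ℕ) (G : SimpleGraph V) : ℕ∞ :=
  ⨅ S : RestrainedFlipSeq G, S.width r

/-- A class `C` has bounded merge-width if for every `r` the supremum over `G ∈ C` of
the radius-`r` merge-widths is finite. -/
def BoundedMergeWidth (C : GraphClass.{u}) : Prop :=
  ∀ r : ℕ, (⨆ G ∈ C, mergeWidth r G.graph) < ⊤

end SparseGraphs

/-! From merge-width to expansion. In one entry of a flip sequence, pairs outside `R` are adjacent
according to the flip alone, and excluding `K_{t,t}` leaves little room for flips between large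
parts: each part has at most `c` special vertices (`IsLevel.card_special_le`), and adjacent vertices
that are not special are at `R`-distance at most 3 (`IsLevel.exists_walk`).

Given the branch sets of a depth-`r` minor, take the last entry at which some branch set `B w` is
free of special vertices; at the next entry every branch set contains one. A walk of length at most
`3r + 1` leads from the centre of `B w` to a special vertex of any adjacent branch set. Cut at the
first special vertex there, it is tracked in `R` with length at most `9r + 3`, except perhaps for a
last edge that comes from a flip. So the neighbours of `w` inject into the special vertices of
boundedly many parts, and the minor is degenerate (`RestrainedFlipSeq.exists_degree_le`).

From expansion to merge-width. The vertices can be ordered so that all short walks from `v` to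
earlier vertices are hit by a bounded set avoiding `v` (`exists_hitting_set`, `exists_rank`).
Iterating these sets bounds the number of vertices before a threshold that are reachable through
vertices after it (`card_reachBelow_le`). The flip sequence isolates the vertices in this order and
groups the others by their neighbourhoods in the isolated ones; the reachable groups then correspond
to subsets of a bounded set. Weak sparsity is immediate: a large biclique is itself a dense depth-0
minor. -/

namespace SparseGraphs

open Finset
open scoped Classical

/-! ### Cutting and transferring walks. -/

section Walks

variable {V : Type*} {G : SimpleGraph V}

/-- A walk from outside a set `D` to a vertex of `D` enters `D` for the first time. -/
theorem exists_first_entry {D : Set V} {a u : V} (p : G.Walk a u) (ha : a ∉ D) (hu : u ∈ D) :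
    ∃ y ∈ p.support, y ∈ D ∧ ∃ (x : V) (q : G.Walk a x), q.length < p.length ∧
      (∀ z ∈ q.support, z ∈ p.support ∧ z ∉ D) ∧ G.Adj x y := by
  induction p with
  | nil => exact absurd hu ha
  | @cons a b u h p ih =>
    by_cases hb : b ∈ D
    · exact ⟨b, by simp, hb, a, .nil, by simp, by simpa using ha, h⟩
    · obtain ⟨y, hy, hyD, x, q, hl, hq, hxy⟩ := ih hb hu
      refine ⟨y, by simp [hy], hyD, x, .cons h q, by simpa using hl, ?_, hxy⟩
      intro z hz
      rw [SimpleGraph.Walk.support_cons, List.mem_cons] at hz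
      rcases hz with rfl | hz
      · exact ⟨by simp, ha⟩
      · exact ⟨by simp [(hq z hz).1], (hq z hz).2⟩

/-- If adjacency among good vertices is realised in `R` within distance `3`, a walk on
good vertices is realised in `R` with at most three times its length. -/
theorem exists_walk_of_walk {R : SimpleGraph V} {good : V → Prop}
    (h : ∀ x y, good x → good y → G.Adj x y → ∃ q : R.Walk x y, q.length ≤ 3) {a b : V}
    (p : G.Walk a b) (hp : ∀ z ∈ p.support, good z) :
    ∃ q : R.Walk a b, q.length ≤ 3 * p.length := by
  induction p with
  | nil => exact ⟨.nil, by simp⟩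
  | @cons a b u hab p ih =>
    obtain ⟨q, hq⟩ := ih (fun z hz => hp z (by simp [hz]))
    obtain ⟨q', hq'⟩ := h a b (hp a (by simp)) (hp b (by simp)) hab
    refine ⟨q'.append q, ?_⟩
    simp only [SimpleGraph.Walk.length_append, SimpleGraph.Walk.length_cons]
    omega

/-- Balls given by walks of `G` inside `B` give walks in the induced subgraph. -/
theorem exists_induce_walk {B : Set V} {c x : V} (hc : c ∈ B) (hx : x ∈ B) {r : ℕ}
    (p : G.Walk c x) (hp : ∀ z ∈ p.support, z ∈ B) (hl : p.length ≤ r) :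
    ∃ q : (G.induce B).Walk ⟨c, hc⟩ ⟨x, hx⟩, q.length ≤ r := by
  refine ⟨p.induce B hp, le_of_eq_of_le ?_ hl⟩
  clear hl
  induction p with
  | nil => rfl
  | cons h p ih =>
    rw [SimpleGraph.Walk.induce_cons, SimpleGraph.Walk.length_cons,
      SimpleGraph.Walk.length_cons, ih]

/-- A walk of an induced subgraph is a walk of `G` inside the set. -/
theorem exists_walk_of_induce {B : Set V} {c x : B} (q : (G.induce B).Walk c x) :
    ∃ p : G.Walk c x, p.length = q.length ∧ ∀ z ∈ p.support, z ∈ B := by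
  induction q with
  | nil => exact ⟨.nil, rfl, by simp⟩
  | @cons a b c h q ih =>
    obtain ⟨p, hl, hp⟩ := ih
    have hab : G.Adj a b := h
    exact ⟨.cons hab p, by simp [hl], by simpa using hp⟩

end Walks

/-! ### Degeneracy, edge counts, independent sets and bicliques. -/

/-- If every nonempty set has a good element, the elements can be ranked so that each one is good
within the set of the elements of at most its rank. -/
theorem exists_rank {V : Type*} (Good : Finset V → V → Prop) (S : Finset V)
    (h : ∀ T ⊆ S, T.Nonempty → ∃ v ∈ T, Good T v) :
    ∃ rank : V → ℕ, Set.InjOn rank S ∧ (∀ v ∈ S, rank v < #S) ∧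
      ∀ v ∈ S, Good {u ∈ S | rank u ≤ rank v} v := by
  induction hn : #S generalizing S with
  | zero =>
    rw [card_eq_zero] at hn
    subst hn
    exact ⟨fun _ => 0, by simp, by simp, by simp⟩
  | succ n ih =>
    -- The element that is good in all of `S` receives the top rank; induction ranks the rest.
    obtain ⟨v, hv, hgood⟩ := h S subset_rfl (card_pos.1 (by omega))
    have hcard : #(S.erase v) = n := by rw [card_erase_of_mem hv, hn]; rfl
    obtain ⟨rank, hinj, hlt, hg⟩ := ih (S.erase v)
      (fun T hT => h T (hT.trans (erase_subset _ _))) hcard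
    have hne : ∀ u ∈ S, u ≠ v → u ∈ S.erase v := fun u hu huv => mem_erase.2 ⟨huv, hu⟩
    refine ⟨Function.update rank v n, ?_, ?_, ?_⟩
    · intro a ha b hb hab
      by_cases hav : a = v <;> by_cases hbv : b = v
      · rw [hav, hbv]
      · subst hav
        have := hlt b (hne b hb hbv)
        simp only [Function.update_self, Function.update_of_ne hbv] at hab
        omega
      · subst hbv
        have := hlt a (hne a ha hav)
        simp only [Function.update_self, Function.update_of_ne hav] at hab
        omega
      · rw [Function.update_of_ne hbv, Function.update_of_ne hav] at hab
        exact hinj (hne a ha hav) (hne b hb hbv) hab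
    · intro a ha
      by_cases hav : a = v
      · subst hav; simp
      · rw [Function.update_of_ne hav]
        exact (hlt a (hne a ha hav)).trans (Nat.lt_succ_self n)
    · intro a ha
      by_cases hav : a = v
      · subst hav
        convert hgood using 1
        refine filter_true_of_mem fun u hu => ?_
        by_cases hua : u = a
        · rw [hua]
        · rw [Function.update_self, Function.update_of_ne hua]
          exact (hlt u (hne u hu hua)).le
      · have ha' := hne a ha hav
        convert hg a ha' using 1
        ext u
        by_cases huv : u = v
        · subst huv
          have := hlt a ha'
          simp [Function.update_of_ne hav, this]
        · simp [Function.update_of_ne hav, huv]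

/-- A degenerate graph has few edges. -/
theorem ncard_edgeSet_le_of_degenerate {W : Type*} [Fintype W] (H : SimpleGraph W) (d : ℕ)
    (h : ∀ T : Finset W, T.Nonempty → ∃ w ∈ T, #{x ∈ T | H.Adj w x} ≤ d) :
    H.edgeSet.ncard ≤ d * Fintype.card W := by
  obtain ⟨rank, -, -, hg⟩ := exists_rank (fun T w => #{x ∈ T | H.Adj w x} ≤ d) univ
    (fun T _ hT => h T hT)
  -- Each edge is charged to its endpoint of higher rank.
  have hsub : H.edgeSet ⊆ ((univ : Finset W).biUnion fun w =>
      ({x ∈ ({u ∈ univ | rank u ≤ rank w} : Finset W) | H.Adj w x}).image (fun x => s(w, x)) :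
      Finset (Sym2 W)) := by
    intro e he
    induction e using Sym2.ind with
    | _ a b =>
      rw [SimpleGraph.mem_edgeSet] at he
      simp only [coe_biUnion, Set.mem_iUnion, mem_coe, mem_image, mem_filter, mem_univ, true_and]
      rcases le_total (rank a) (rank b) with hab | hab
      · exact ⟨b, trivial, a, ⟨hab, he.symm⟩, Sym2.eq_swap⟩
      · exact ⟨a, trivial, b, ⟨hab, he⟩, rfl⟩
  calc H.edgeSet.ncard ≤ _ := Set.ncard_le_ncard hsub (finite_toSet _)
    _ = _ := Set.ncard_coe_finset _
    _ ≤ #(univ : Finset W) * d := card_biUnion_le_card_mul _ _ _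
        (fun w hw => card_image_le.trans (hg w hw))
    _ = d * Fintype.card W := by rw [mul_comm, card_univ]

/-- The density bound of bounded expansion for minors on an arbitrary finite vertex type. -/
theorem sum_degree_le {V : Type u} {G : SimpleGraph V} {r d : ℕ}
    (hd : ∀ (n : ℕ) (H : SimpleGraph (Fin n)), IsShallowMinor r H G → H.edgeSet.ncard ≤ d * n)
    {W : Type*} [Fintype W] (H : SimpleGraph W) (hH : IsShallowMinor r H G) :
    ∑ w, #{x | H.Adj w x} ≤ 2 * (d * Fintype.card W) := by
  let e := Fintype.equivFin W
  have hm : IsShallowMinor r (H.comap e.symm) G := by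
    obtain ⟨B, h1, h2, h3⟩ := hH
    exact ⟨fun i => B (e.symm i), fun i j hij => h1 _ _ (by simpa using hij),
      fun i => h2 _, fun i j hij => h3 _ _ hij⟩
  have hcard := hd _ _ hm
  have hiso : (H.comap e.symm).edgeSet.ncard = H.edgeSet.ncard := by
    rw [← Nat.card_coe_set_eq, ← Nat.card_coe_set_eq]
    exact Nat.card_congr (SimpleGraph.Iso.comap e.symm H).mapEdgeSet
  have hs := H.sum_degrees_eq_twice_card_edges
  have h4 : #H.edgeFinset = H.edgeSet.ncard := by
    rw [← SimpleGraph.coe_edgeFinset, Set.ncard_coe_finset]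
  calc ∑ w, #{x | H.Adj w x} = ∑ w, H.degree w := by
        refine sum_congr rfl fun w _ => ?_
        rw [← SimpleGraph.card_neighborFinset_eq_degree, SimpleGraph.neighborFinset_eq_filter]
    _ ≤ _ := by rw [hs, h4, ← hiso]; omega

/-- A sparse graph has a large independent set. -/
theorem exists_indep {W : Type*} [Fintype W] (H : SimpleGraph W) (d : ℕ)
    (h : ∑ w, #{x | H.Adj w x} ≤ 2 * (d * Fintype.card W)) :
    ∃ R : Finset W, Fintype.card W ≤ 2 * ((4 * d + 1) * #R) ∧
      ∀ x ∈ R, ∀ y ∈ R, ¬ H.Adj x y := by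
  -- The average degree is at most `2 * d`, so at least half of the vertices have degree at most `4
  -- * d`. The closed neighbourhoods of a maximal independent subset of `L` cover `L`.
  set L : Finset W := {w | #{x | H.Adj w x} ≤ 4 * d} with hL
  have h1 : #Lᶜ * (4 * d + 1) ≤ 2 * (d * Fintype.card W) := by
    refine le_trans ?_ h
    calc #Lᶜ * (4 * d + 1) ≤ ∑ w ∈ Lᶜ, #{x | H.Adj w x} := by
          rw [← smul_eq_mul]
          refine card_nsmul_le_sum _ _ _ fun w hw => ?_
          simp only [hL, mem_compl, mem_filter, mem_univ, true_and, not_le] at hw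
          exact hw
      _ ≤ _ := sum_le_sum_of_subset (subset_univ _)
  have h2 : Fintype.card W ≤ 2 * #L := by
    have := card_add_card_compl L
    nlinarith
  obtain ⟨R, hR⟩ := Set.Finite.exists_maximal
    (s := {R : Finset W | R ⊆ L ∧ ∀ x ∈ R, ∀ y ∈ R, ¬ H.Adj x y}) (Set.toFinite _) ⟨∅, by simp⟩
  refine ⟨R, ?_, hR.1.2⟩
  have h3 : L ⊆ R.biUnion fun v => insert v ({x | H.Adj v x} : Finset W) := by
    intro v hv
    by_contra hcon
    simp only [mem_biUnion, mem_insert, mem_filter, mem_univ, true_and, not_exists, not_and,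
      not_or] at hcon
    have hins : insert v R ≤ R := hR.2 (y := insert v R) ⟨insert_subset hv hR.1.1, by
      intro x hx y hy hxy
      rw [mem_insert] at hx hy
      rcases hx with rfl | hx <;> rcases hy with rfl | hy
      · exact H.irrefl hxy
      · exact (hcon y hy).2 hxy.symm
      · exact (hcon x hx).2 hxy
      · exact hR.1.2 x hx y hy hxy⟩ (subset_insert _ _)
    exact (hcon v (hins (mem_insert_self _ _))).1 rfl
  have h4 : #L ≤ #R * (4 * d + 1) := by
    refine (card_le_card h3).trans (card_biUnion_le_card_mul _ _ _ fun v hv => ?_)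
    refine (card_insert_le _ _).trans (Nat.succ_le_succ ?_)
    have := hR.1.1 hv
    rw [hL, mem_filter] at this
    exact this.2
  rw [mul_comm] at h4
  omega

/-- A `K_{t,t}`-free graph has a missing edge between any two disjoint sets of size `t`. -/
theorem BicliqueFree.exists_not_adj {V : Type u} {G : SimpleGraph V} {t : ℕ}
    (h : BicliqueFree t G) (X Y : Finset V) (hXY : Disjoint X Y) (hX : t ≤ #X) (hY : t ≤ #Y) :
    ∃ x ∈ X, ∃ y ∈ Y, ¬ G.Adj x y := by
  by_contra! hcon
  obtain ⟨f⟩ : Nonempty (Fin t ↪ X) := Function.Embedding.nonempty_of_card_le (by simpa using hX)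
  obtain ⟨g⟩ : Nonempty (Fin t ↪ Y) := Function.Embedding.nonempty_of_card_le (by simpa using hY)
  refine h ⟨⟨⟨Sum.elim (fun i => (f i : V)) (fun i => (g i : V)), ?_⟩, ?_⟩⟩
  · intro a b hab
    rcases a with a | a <;> rcases b with b | b
    · simp at hab
    · exact hcon _ (f a).2 _ (g b).2
    · exact (hcon _ (f b).2 _ (g a).2).symm
    · simp at hab
  · have hne : ∀ i j, (f i : V) ≠ g j := fun i j hij =>
      disjoint_left.1 hXY (f i).2 (hij ▸ (g j).2)
    intro a b hab
    rcases a with a | a <;> rcases b with b | b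
    · exact congrArg _ (f.injective (Subtype.ext hab))
    · exact absurd hab (hne _ _)
    · exact absurd hab.symm (hne _ _)
    · exact congrArg _ (g.injective (Subtype.ext hab))

/-! ### A single entry of a flip sequence in a biclique-free graph. -/

/-- The data `(P, R, F)` of an entry of a restrained flip sequence for `G`: pairs outside `R` are
adjacent in `G` exactly if their parts form a flipped pair, and every vertex has `R`-neighbours in
at most `k` parts. -/
structure IsLevel {V : Type u} (G : SimpleGraph V) (P : Setoid V) (R : SimpleGraph V)
    (F : Set (Sym2 (Quotient P))) (k : ℕ) : Prop where
  adj_iff : ∀ u v, u ≠ v → ¬ R.Adj u v →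
    (G.Adj u v ↔ s(Quotient.mk P u, Quotient.mk P v) ∈ F)
  card_le : ∀ v, ∀ Y : Finset V, (∀ y ∈ Y, R.Adj v y) →
    Set.InjOn (Quotient.mk P) (Y : Set V) → #Y ≤ k

section Level

variable {V : Type u} [Fintype V] {G : SimpleGraph V} {P : Setoid V} {R : SimpleGraph V}
  {F : Set (Sym2 (Quotient P))} {k t c : ℕ}

/-- The vertices in a part. -/
noncomputable def cls (P : Setoid V) (a : Quotient P) : Finset V := {v | Quotient.mk P v = a}

/-- A vertex is special if its part has fewer than `c` vertices, or it has fewer than `t`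
`R`-neighbours in some part with at least `c` vertices that is flipped with its own. -/
def Special (P : Setoid V) (R : SimpleGraph V) (F : Set (Sym2 (Quotient P))) (t c : ℕ) (v : V) :
    Prop :=
  #(cls P (Quotient.mk P v)) < c ∨ ∃ b, s(Quotient.mk P v, b) ∈ F ∧ c ≤ #(cls P b) ∧
    #{w ∈ cls P b | R.Adj v w} < t

theorem mem_cls {a : Quotient P} {v : V} : v ∈ cls P a ↔ Quotient.mk P v = a := by
  simp [cls]

/-- A large part is flipped with few parts. -/
theorem IsLevel.card_flipped_le (hl : IsLevel G P R F k) (hf : BicliqueFree t G)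
    (hc : 2 ^ (k + t) * t ≤ c) {a : Quotient P} (ha : c ≤ #(cls P a)) :
    #{b | s(a, b) ∈ F} ≤ k + t := by
  by_contra! hcon
  -- Dropping `a` itself keeps the representatives outside `cls P a`, so that the two sides of the
  -- biclique are disjoint.
  have h1 : k + t ≤ #(({b | s(a, b) ∈ F} : Finset (Quotient P)).erase a) := by
    have := pred_card_le_card_erase (s := ({b | s(a, b) ∈ F} : Finset (Quotient P))) (a := a)
    omega
  obtain ⟨𝓑, h𝓑, hcard⟩ := exists_subset_card_eq h1
  have hout : Set.InjOn (Quotient.out : Quotient P → V) 𝓑 :=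
    (Function.LeftInverse.injective (fun b => Quotient.out_eq b)).injOn
  set Y : Finset V := 𝓑.image Quotient.out with hY
  have hYcard : #Y = k + t := by rw [hY, card_image_of_injOn hout, hcard]
  have hYinj : Set.InjOn (Quotient.mk P) (Y : Set V) := by
    intro y hy y' hy' h
    simp only [hY, coe_image, Set.mem_image, mem_coe] at hy hy'
    obtain ⟨b, -, rfl⟩ := hy
    obtain ⟨b', -, rfl⟩ := hy'
    have : b = b' := by simpa using! h
    rw [this]
  have hYF : ∀ y ∈ Y, s(a, Quotient.mk P y) ∈ F ∧ Quotient.mk P y ≠ a := by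
    intro y hy
    obtain ⟨b, hb, rfl⟩ := mem_image.1 hy
    have h2 := h𝓑 hb
    rw [mem_erase, mem_filter] at h2
    have h3 : Quotient.mk P b.out = b := Quotient.out_eq b
    rw [h3]
    exact ⟨h2.2.2, h2.1⟩
  have hN : ∀ x, t ≤ #{y ∈ Y | ¬ R.Adj x y} := by
    intro x
    have h2 := card_filter_add_card_filter_not (s := Y) (fun y => R.Adj x y)
    have h3 := hl.card_le x {y ∈ Y | R.Adj x y} (fun y hy => (mem_filter.1 hy).2)
      (hYinj.mono (coe_subset.2 (filter_subset _ _)))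
    omega
  -- Pigeonhole over the `2 ^ (k + t)` subsets of `Y`: some `t` vertices of the part have the same
  -- `R`-non-neighbours in `Y`, at least `t` of them, and the flip makes these pairs adjacent in
  -- `G`.
  obtain ⟨N, hN', hfib⟩ := exists_le_card_fiber_of_mul_le_card_of_maps_to (s := cls P a)
    (t := Y.powerset) (f := fun x => {y ∈ Y | ¬ R.Adj x y}) (n := t)
    (fun x _ => by simp) ⟨∅, by simp⟩ (by rw [card_powerset, hYcard]; omega)
  rcases Nat.eq_zero_or_pos t with rfl | ht
  · obtain ⟨x, hx, -⟩ := hf.exists_not_adj ∅ ∅ (by simp) (by simp) (by simp)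
    simp at hx
  have hNt : t ≤ #N := by
    obtain ⟨x, hx⟩ := card_pos.1 (lt_of_lt_of_le ht hfib)
    rw [← (mem_filter.1 hx).2]
    exact hN x
  rw [mem_powerset] at hN'
  obtain ⟨x, hx, y, hy, hxy⟩ := hf.exists_not_adj _ N (by
    rw [disjoint_left]
    intro x hx hxN
    exact (hYF x (hN' hxN)).2 (mem_cls.1 (mem_filter.1 hx).1)) hfib hNt
  obtain ⟨hxa, hxN⟩ := mem_filter.1 hx
  rw [mem_cls] at hxa
  have hyF := hYF y (hN' hy)
  rw [← hxN, mem_filter] at hy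
  refine hxy ((hl.adj_iff x y ?_ hy.2).2 (by rw [hxa]; exact hyF.1))
  rintro rfl
  exact hyF.2 hxa

/-- For flipped parts `a` and `b`, few vertices of `a` have few `R`-neighbours in `b`. -/
theorem IsLevel.card_exceptional_le (hl : IsLevel G P R F k) (hf : BicliqueFree t G)
    (hc : t * t + 2 * t ≤ c) {a b : Quotient P} (hab : s(a, b) ∈ F) (hb : c ≤ #(cls P b)) :
    #{v ∈ cls P a | #{w ∈ cls P b | R.Adj v w} < t} ≤ t := by
  by_contra! hcon
  obtain ⟨X, hX, hXt⟩ := exists_subset_card_eq hcon.le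
  set Z : Finset V := X.biUnion (fun v => {w ∈ cls P b | R.Adj v w}) with hZ
  have hZc : #Z ≤ t * t := by
    rw [hZ]
    refine (card_biUnion_le_card_mul _ _ t fun v hv => ?_).trans (by rw [hXt])
    exact (mem_filter.1 (hX hv)).2.le
  -- Removing `X` and the `R`-neighbours of `X` leaves at least `c - t - t * t ≥ t` vertices of `b`,
  -- all joined to `X` by the flip.
  obtain ⟨x, hx, y, hy, hxy⟩ := hf.exists_not_adj X (cls P b \ (X ∪ Z)) (by
    rw [disjoint_left]
    intro x hx hx'
    simp [hx] at hx') hXt.ge (by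
    have h1 := le_card_sdiff (X ∪ Z) (cls P b)
    have h2 := card_union_le X Z
    omega)
  simp only [mem_sdiff, mem_union, not_or] at hy
  have hxa := (mem_filter.1 (hX hx)).1
  rw [mem_cls] at hxa
  have hyb := mem_cls.1 hy.1
  refine hxy ((hl.adj_iff x y ?_ ?_).2 (by rw [hxa, hyb]; exact hab))
  · rintro rfl
    exact hy.2.1 hx
  · intro hR
    exact hy.2.2 (mem_biUnion.2 ⟨x, hx, mem_filter.2 ⟨hy.1, hR⟩⟩)

/-- A part contains few special vertices. -/
theorem IsLevel.card_special_le (hl : IsLevel G P R F k) (hf : BicliqueFree t G)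
    (hc₁ : 2 ^ (k + t) * t ≤ c) (hc₂ : t * t + 2 * t ≤ c) (hc₃ : (k + t) * t ≤ c)
    (a : Quotient P) : #{v ∈ cls P a | Special P R F t c v} ≤ c := by
  rcases lt_or_ge #(cls P a) c with ha | ha
  · exact (card_filter_le _ _).trans ha.le
  have hsub : {v ∈ cls P a | Special P R F t c v} ⊆
      ({b | s(a, b) ∈ F ∧ c ≤ #(cls P b)} : Finset (Quotient P)).biUnion
        fun b => {v ∈ cls P a | #{w ∈ cls P b | R.Adj v w} < t} := by
    intro v hv
    obtain ⟨hva, hs⟩ := mem_filter.1 hv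
    have hva' := mem_cls.1 hva
    rcases hs with hs | ⟨b, hb1, hb2, hb3⟩
    · rw [hva'] at hs
      omega
    · rw [hva'] at hb1
      exact mem_biUnion.2 ⟨b, by simp [hb1, hb2], mem_filter.2 ⟨hva, hb3⟩⟩
  refine (card_le_card hsub).trans ((card_biUnion_le_card_mul _ _ t fun b hb => ?_).trans ?_)
  · simp only [mem_filter, mem_univ, true_and] at hb
    exact hl.card_exceptional_le hf hc₂ hb.1 hb.2
  · refine le_trans (Nat.mul_le_mul_right t ?_) hc₃
    refine le_trans (card_le_card ?_) (hl.card_flipped_le hf hc₁ ha)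
    intro b hb
    simp only [mem_filter, mem_univ, true_and] at hb ⊢
    exact hb.1

/-- Adjacent vertices that are not special are close in `R`. -/
theorem IsLevel.exists_walk (hl : IsLevel G P R F k) (hf : BicliqueFree t G) {x y : V}
    (hx : ¬ Special P R F t c x) (hy : ¬ Special P R F t c y) (hxy : G.Adj x y) :
    ∃ q : R.Walk x y, q.length ≤ 3 := by
  by_cases hR : R.Adj x y
  · exact ⟨hR.toWalk, by simp⟩
  have hF := (hl.adj_iff x y hxy.ne hR).1 hxy
  simp only [Special, not_or, not_lt, not_exists, not_and] at hx hy
  have hX := hx.2 _ hF hy.1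
  have hY := hy.2 _ (by rw [Sym2.eq_swap]; exact hF) hx.1
  set X : Finset V := {w ∈ cls P (Quotient.mk P y) | R.Adj x w}
  set Y : Finset V := {w ∈ cls P (Quotient.mk P x) | R.Adj y w}
  by_cases hd : Disjoint X Y
  -- `X` and `Y` lie in flipped parts, so a non-edge of `G` between them must be an edge of `R`:
  -- this gives the path `x, a, b, y`.
  · obtain ⟨a, ha, b, hb, hab⟩ := hf.exists_not_adj X Y hd hX hY
    have hne : a ≠ b := by
      rintro rfl
      exact disjoint_left.1 hd ha hb
    obtain ⟨ha1, ha2⟩ := mem_filter.1 ha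
    obtain ⟨hb1, hb2⟩ := mem_filter.1 hb
    rw [mem_cls] at ha1 hb1
    have hRab : R.Adj a b := by
      by_contra hR'
      exact hab ((hl.adj_iff a b hne hR').2 (by rw [ha1, hb1, Sym2.eq_swap]; exact hF))
    exact ⟨.cons ha2 (.cons hRab (.cons hb2.symm .nil)), by simp⟩
  · rw [disjoint_left] at hd
    push Not at hd
    obtain ⟨z, hz1, hz2⟩ := hd
    exact ⟨.cons (mem_filter.1 hz1).2 (.cons (mem_filter.1 hz2).2.symm .nil), by simp⟩

/-- Few special vertices lie in a few parts. -/
theorem IsLevel.card_special_mem_le (hl : IsLevel G P R F k) (hf : BicliqueFree t G)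
    (hc₁ : 2 ^ (k + t) * t ≤ c) (hc₂ : t * t + 2 * t ≤ c) (hc₃ : (k + t) * t ≤ c)
    (𝒜 : Finset (Quotient P)) :
    #{v | Special P R F t c v ∧ Quotient.mk P v ∈ 𝒜} ≤ #𝒜 * c := by
  refine le_trans (card_le_card ?_) (card_biUnion_le_card_mul 𝒜
    (fun a => {v ∈ cls P a | Special P R F t c v}) c
    fun a _ => hl.card_special_le hf hc₁ hc₂ hc₃ a)
  intro v hv
  simp only [mem_filter, mem_univ, true_and] at hv
  exact mem_biUnion.2 ⟨_, hv.2, mem_filter.2 ⟨mem_cls.2 rfl, hv.1⟩⟩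

end Level

/-! ### Shallow minors are degenerate. -/

theorem mk_mem_reachableParts {V : Type u} {R : SimpleGraph V} (P : Setoid V) {r : ℕ} {v u : V}
    (q : R.Walk v u) (hq : q.length ≤ r) : Quotient.mk P u ∈ reachableParts r P R v :=
  ⟨u, rfl, q.bypass, q.bypass_isPath, q.length_bypass_le_length.trans hq⟩

theorem RestrainedFlipSeq.encard_reachableParts_le {V : Type u} {G : SimpleGraph V}
    (S : RestrainedFlipSeq G) {r k : ℕ} (hS : S.width r ≤ k) (i : Fin S.m) (v : V) :
    (reachableParts r (S.P i.succ) (S.R i.castSucc) v).encard ≤ k :=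
  le_trans (le_iSup (fun v => (reachableParts r (S.P i.succ) (S.R i.castSucc) v).encard) v)
    (le_trans (le_iSup (fun i : Fin S.m => radiusWidth r (S.P i.succ) (S.R i.castSucc)) i) hS)

/-- Every entry of a restrained flip sequence of bounded width is a level. -/
theorem RestrainedFlipSeq.exists_isLevel {V : Type u} {G : SimpleGraph V}
    (S : RestrainedFlipSeq G) {r k : ℕ} (hr : 1 ≤ r) (hS : S.width r ≤ k) (i : Fin (S.m + 1)) :
    ∃ F, IsLevel G (S.P i) (S.R i) F k := by
  obtain ⟨F, hF⟩ := S.isFlip i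
  refine ⟨F, ?_, ?_⟩
  · intro u v huv hR
    have h1 := hF u v huv
    have h2 : ¬ (S.flip i).Adj u v := fun h => hR (S.flip_le i h)
    simp only [h2, false_iff, Xor] at h1
    tauto
  · intro v Y hY hinj
    -- The width pairs `R i` with the finer partition `P (i + 1)`, which does not exist at the last
    -- index; there `R` is empty.
    induction i using Fin.lastCases with
    | last =>
      rw [S.R_last] at hY
      have : Y = ∅ := eq_empty_of_forall_notMem fun y hy => hY y hy
      simp [this]
    | cast i =>
      have hinj' : Set.InjOn (Quotient.mk (S.P i.succ)) (Y : Set V) := by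
        intro a ha b hb hab
        refine hinj ha hb (Quotient.sound ?_)
        exact S.P_antitone (Fin.castSucc_lt_succ (i := i)).le (Quotient.exact hab)
      have hsub : Quotient.mk (S.P i.succ) '' (Y : Set V) ⊆
          reachableParts r (S.P i.succ) (S.R i.castSucc) v := by
        rintro _ ⟨y, hy, rfl⟩
        exact mk_mem_reachableParts _ (hY y hy).toWalk (by simpa using hr)
      have h1 := (Set.encard_le_encard hsub).trans (S.encard_reachableParts_le hS i v)
      rw [hinj'.encard_image, Set.encard_coe_eq_coe_finsetCard] at h1
      exact_mod_cast h1

/-- Shallow minors of a biclique-free graph with a restrained flip sequence of bounded width are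
degenerate. -/
theorem RestrainedFlipSeq.exists_degree_le {V : Type u} [Fintype V] {G : SimpleGraph V}
    (S : RestrainedFlipSeq G) {r k t c : ℕ} (hS : S.width (9 * r + 3) ≤ k) (hf : BicliqueFree t G)
    (hc₀ : 2 ≤ c) (hc₁ : 2 ^ (k + t) * t ≤ c) (hc₂ : t * t + 2 * t ≤ c) (hc₃ : (k + t) * t ≤ c)
    {W : Type*} {H : SimpleGraph W} (hH : IsShallowMinor r H G) (T : Finset W)
    (hT : T.Nonempty) :
    ∃ w ∈ T, #{x ∈ T | H.Adj w x} ≤ k * c + (k + k * (k + t)) * c + c := by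
  obtain ⟨B, hdisj, hcen, hadj⟩ := hH
  choose F hF using S.exists_isLevel (by omega : 1 ≤ 9 * r + 3) hS
  let Sp : Fin (S.m + 1) → V → Prop := fun i => Special (S.P i) (S.R i) (F i) t c
  have hlast : ∀ v, Sp (Fin.last _) v := by
    intro v
    left
    refine lt_of_le_of_lt ?_ hc₀
    refine card_le_one.2 fun a ha b hb => ?_
    rw [mem_cls] at ha hb
    have h1 := Quotient.exact (ha.trans hb.symm)
    have h2 : S.P (Fin.last _) a b := h1
    rw [S.P_last] at h2
    exact h2
  by_cases hex : ∃ j : Fin (S.m + 1), ∃ w ∈ T, ∀ x ∈ B w, ¬ Sp j x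
  swap
  -- With a special vertex in every branch set already at entry 0, whose partition has one part,
  -- there are at most `c` branch sets.
  · push Not at hex
    obtain ⟨w, hw⟩ := hT
    refine ⟨w, hw, ?_⟩
    have : Nonempty V := ⟨(hcen w).choose⟩
    choose! s hs hsp using hex 0
    have hinj : Set.InjOn s (T : Set W) := by
      intro a ha b hb hab
      by_contra hne
      exact Set.disjoint_left.1 (hdisj a b hne) (hs a ha) (hab ▸ hs b hb)
    have h1 : #T ≤ c := by
      rw [← card_image_of_injOn hinj]
      refine le_trans (card_le_card ?_)
        ((hF 0).card_special_le hf hc₁ hc₂ hc₃ (Quotient.mk _ (s w)))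
      intro v hv
      obtain ⟨a, ha, rfl⟩ := mem_image.1 hv
      refine mem_filter.2 ⟨mem_cls.2 (Quotient.sound ?_), hsp a ha⟩
      change S.P 0 _ _
      rw [S.P_zero]
      trivial
    exact (card_filter_le _ _).trans (h1.trans (Nat.le_add_left _ _))
  -- The last such entry is not the final one, where every part is a singleton and `2 ≤ c` makes all
  -- vertices special.
  obtain ⟨j, hj⟩ := Set.Finite.exists_maximal
    (s := {j : Fin (S.m + 1) | ∃ w ∈ T, ∀ x ∈ B w, ¬ Sp j x}) (Set.toFinite _) hex
  obtain ⟨w, hwT, hw⟩ := hj.1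
  induction j using Fin.lastCases with
  | last =>
    obtain ⟨z, -⟩ := hcen w
    exact absurd (hlast z) (hw z z.2)
  | cast i =>
  have hnext : ∀ w' ∈ T, ∃ x ∈ B w', Sp i.succ x := by
    by_contra! hcon
    exact absurd (hj.2 (y := i.succ) hcon (Fin.castSucc_lt_succ (i := i)).le)
      (not_le.2 (Fin.castSucc_lt_succ (i := i)))
  obtain ⟨z, hz⟩ := hcen w
  refine ⟨w, hwT, ?_⟩
  have hfin : (reachableParts (9 * r + 3) (S.P i.succ) (S.R i.castSucc) z).Finite :=
    Set.toFinite _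
  set 𝒜₁ : Finset (Quotient (S.P i.succ)) := hfin.toFinset with h𝒜₁
  have h𝒜₁c : #𝒜₁ ≤ k := by
    have := S.encard_reachableParts_le hS i z
    rw [hfin.encard_eq_coe_toFinset_card] at this
    exact_mod_cast this
  have hle : S.P i.succ ≤ S.P i.castSucc := S.P_antitone (Fin.castSucc_lt_succ (i := i)).le
  set 𝒜₀ : Finset (Quotient (S.P i.castSucc)) :=
    𝒜₁.image (fun a => Quotient.mk _ a.out) with h𝒜₀
  have h𝒜₀c : #𝒜₀ ≤ k := card_image_le.trans h𝒜₁c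
  have hreach : ∀ {s : V} (q : (S.R i.castSucc).Walk z s), q.length ≤ 9 * r + 3 →
      Quotient.mk _ s ∈ 𝒜₁ ∧ Quotient.mk _ s ∈ 𝒜₀ := by
    intro s q hq
    have h1 : Quotient.mk _ s ∈ 𝒜₁ := by
      rw [h𝒜₁, Set.Finite.mem_toFinset]
      exact mk_mem_reachableParts _ q hq
    refine ⟨h1, mem_image.2 ⟨_, h1, Quotient.sound ?_⟩⟩
    exact hle (Quotient.exact (Quotient.out_eq (Quotient.mk (S.P i.succ) s)))
  -- Besides the reachable parts, this holds the parts flipped with a large reachable part, to catch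
  -- walks whose last edge comes from a flip.
  set 𝒜₂ : Finset (Quotient (S.P i.castSucc)) := 𝒜₀ ∪
    ({a ∈ 𝒜₀ | c ≤ #(cls _ a)}).biUnion (fun a => {b | s(a, b) ∈ F i.castSucc}) with h𝒜₂
  have h𝒜₂c : #𝒜₂ ≤ k + k * (k + t) := by
    refine (card_union_le _ _).trans (Nat.add_le_add h𝒜₀c ?_)
    refine (card_biUnion_le_card_mul _ _ (k + t) fun a ha => ?_).trans
      (Nat.mul_le_mul_right _ ((card_filter_le _ _).trans h𝒜₀c))
    exact (hF i.castSucc).card_flipped_le hf hc₁ (mem_filter.1 ha).2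
  have key : ∀ x ∈ T, H.Adj w x → ∃ s ∈ B x,
      (Sp i.succ s ∧ Quotient.mk _ s ∈ 𝒜₁) ∨ (Sp i.castSucc s ∧ Quotient.mk _ s ∈ 𝒜₂) := by
    intro x hx hwx
    obtain ⟨s₀, hs₀, hsp₀⟩ := hnext x hx
    obtain ⟨a, ha, b, hb, hab⟩ := hadj w x hwx
    obtain ⟨z', hz'⟩ := hcen x
    obtain ⟨q₁, hq₁⟩ := hz ⟨a, ha⟩
    obtain ⟨q₂, hq₂⟩ := hz' ⟨b, hb⟩
    obtain ⟨q₃, hq₃⟩ := hz' ⟨s₀, hs₀⟩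
    obtain ⟨p₁, hl₁, hp₁⟩ := exists_walk_of_induce q₁
    obtain ⟨p₂, hl₂, hp₂⟩ := exists_walk_of_induce q₂
    obtain ⟨p₃, hl₃, hp₃⟩ := exists_walk_of_induce q₃
    let p : G.Walk z s₀ := p₁.append (.cons hab (p₂.reverse.append p₃))
    have hpl : p.length ≤ 3 * r + 1 := by
      simp only [p, SimpleGraph.Walk.length_append, SimpleGraph.Walk.length_cons,
        SimpleGraph.Walk.length_reverse]
      omega
    have hps : ∀ y ∈ p.support, y ∈ B w ∨ y ∈ B x := by
      intro y hy
      simp only [p, SimpleGraph.Walk.mem_support_append_iff, SimpleGraph.Walk.support_cons,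
        List.mem_cons, SimpleGraph.Walk.support_reverse, List.mem_reverse] at hy
      rcases hy with hy | rfl | hy | hy
      · exact .inl (hp₁ _ hy)
      · exact .inl ha
      · exact .inr (hp₂ _ hy)
      · exact .inr (hp₃ _ hy)
    -- Stopping at the first vertex of `B x` that is special at either entry keeps all earlier
    -- vertices non-special at entry `i`, since `B w` has no such vertices. As `q` has length at
    -- most `3 * r`, it is tracked in `R` with length at most `9 * r`.
    obtain ⟨s, -, ⟨hsB, hsS⟩, y, q, hql, hq, hys⟩ := exists_first_entry
      (D := {y | y ∈ B x ∧ (Sp i.castSucc y ∨ Sp i.succ y)}) p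
      (fun h => Set.disjoint_left.1 (hdisj w x hwx.ne) z.2 h.1) ⟨hs₀, .inr hsp₀⟩
    have hgood : ∀ y ∈ q.support, ¬ Sp i.castSucc y := by
      intro y hy hsp
      obtain ⟨h1, h2⟩ := hq y hy
      rcases hps y h1 with h3 | h3
      · exact hw y h3 hsp
      · exact h2 ⟨h3, .inl hsp⟩
    obtain ⟨q', hq'⟩ := exists_walk_of_walk (good := fun y => ¬ Sp i.castSucc y)
      (fun _ _ hx hy hxy => (hF i.castSucc).exists_walk hf hx hy hxy) q hgood
    refine ⟨s, hsB, ?_⟩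
    -- Either the last edge is tracked by 3 more steps, or `s` must be special at entry `i` and its
    -- part is flipped with the large part of `y`.
    by_cases hclose : ∃ q'' : (S.R i.castSucc).Walk y s, q''.length ≤ 3
    · obtain ⟨q'', hq''⟩ := hclose
      obtain ⟨h1, h2⟩ := hreach (q'.append q'')
        (by rw [SimpleGraph.Walk.length_append]; omega)
      rcases hsS with hsS | hsS
      · exact .inr ⟨hsS, mem_union_left _ h2⟩
      · exact .inl ⟨hsS, h1⟩
    · have hy0 : ¬ Sp i.castSucc y := hgood y q.end_mem_support
      have hs0 : Sp i.castSucc s := by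
        by_contra hs0
        exact hclose ((hF i.castSucc).exists_walk hf hy0 hs0 hys)
      have hR : ¬ (S.R i.castSucc).Adj y s := fun h => hclose ⟨h.toWalk, by simp⟩
      refine .inr ⟨hs0, mem_union_right _ (mem_biUnion.2 ⟨Quotient.mk _ y, ?_, ?_⟩)⟩
      · refine mem_filter.2 ⟨(hreach q' (by omega)).2, ?_⟩
        by_contra hlt
        exact hy0 (.inl (not_le.1 hlt))
      · exact mem_filter.2 ⟨mem_univ _, ((hF i.castSucc).adj_iff y s hys.ne hR).1 hys⟩
  have : Nonempty V := ⟨z⟩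
  choose! s hsB hs using key
  have hinj : Set.InjOn s ({x ∈ T | H.Adj w x} : Finset W) := by
    intro a ha b hb hab
    obtain ⟨ha1, ha2⟩ := mem_filter.1 ha
    obtain ⟨hb1, hb2⟩ := mem_filter.1 hb
    by_contra hne
    exact Set.disjoint_left.1 (hdisj a b hne) (hsB a ha1 ha2) (hab ▸ hsB b hb1 hb2)
  rw [← card_image_of_injOn hinj]
  have hsub : ({x ∈ T | H.Adj w x}).image s ⊆
      ({v | Sp i.succ v ∧ Quotient.mk _ v ∈ 𝒜₁} : Finset V) ∪
        ({v | Sp i.castSucc v ∧ Quotient.mk _ v ∈ 𝒜₂} : Finset V) := by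
    intro v hv
    obtain ⟨x, hx, rfl⟩ := mem_image.1 hv
    obtain ⟨hx1, hx2⟩ := mem_filter.1 hx
    simpa using! hs x hx1 hx2
  calc _ ≤ _ := card_le_card hsub
    _ ≤ _ := card_union_le _ _
    _ ≤ #𝒜₁ * c + #𝒜₂ * c := Nat.add_le_add
        ((hF i.succ).card_special_mem_le hf hc₁ hc₂ hc₃ 𝒜₁)
        ((hF i.castSucc).card_special_mem_le hf hc₁ hc₂ hc₃ 𝒜₂)
    _ ≤ k * c + (k + k * (k + t)) * c := Nat.add_le_add (Nat.mul_le_mul_right _ h𝒜₁c)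
        (Nat.mul_le_mul_right _ h𝒜₂c)
    _ ≤ _ := Nat.le_add_right _ _

/-- A weakly sparse class of bounded merge-width has bounded expansion. -/
theorem WeaklySparse.boundedExpansion {C : GraphClass.{u}} (hC : WeaklySparse C)
    (hw : BoundedMergeWidth C) : BoundedExpansion C := by
  intro r
  obtain ⟨t, ht⟩ := hC
  obtain ⟨k, hk⟩ := ENat.exists_nat_gt (hw (9 * r + 3)).ne
  set c := 2 + 2 ^ (k + t) * t + (t * t + 2 * t) + (k + t) * t with hc
  refine ⟨k * c + (k + k * (k + t)) * c + c, fun G hG n H hH => ?_⟩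
  have := G.finite
  have := Fintype.ofFinite G.V
  have hlt : mergeWidth (9 * r + 3) G.graph < k :=
    lt_of_le_of_lt (le_iSup₂ (f := fun G (_ : G ∈ C) => mergeWidth (9 * r + 3) G.graph) G hG) hk
  obtain ⟨S, hS⟩ := iInf_lt_iff.1 hlt
  have := ncard_edgeSet_le_of_degenerate H _ fun T hT =>
    S.exists_degree_le (c := c) hS.le (ht G hG) (by omega) (by omega) (by omega) (by omega)
      hH T hT
  simpa using this

/-! ### Bounded expansion excludes a biclique. -/

/-- A class of bounded expansion is weakly sparse. -/
theorem BoundedExpansion.weaklySparse {C : GraphClass.{u}} (hC : BoundedExpansion C) :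
    WeaklySparse C := by
  obtain ⟨d, hd⟩ := hC 0
  refine ⟨2 * d + 1, fun G hG => ?_⟩
  rintro ⟨f⟩
  have hm : IsShallowMinor 0 (completeBipartiteGraph (Fin (2 * d + 1)) (Fin (2 * d + 1)))
      G.graph := by
    refine ⟨fun w => {f w}, ?_, ?_, ?_⟩
    · intro w w' hne
      rw [Set.disjoint_singleton]
      exact fun h => hne (f.injective h)
    · intro w
      refine ⟨⟨f w, rfl⟩, ?_⟩
      rintro ⟨x, rfl⟩
      exact ⟨.nil, le_rfl⟩
    · intro w w' h
      exact ⟨_, rfl, _, rfl, f.toHom.map_adj h⟩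
  have h1 := sum_degree_le (hd G hG) _ hm
  have h2 : ∀ w : Fin (2 * d + 1) ⊕ Fin (2 * d + 1), 2 * d + 1 ≤
      #{x | (completeBipartiteGraph (Fin (2 * d + 1)) (Fin (2 * d + 1))).Adj w x} := by
    rintro (w | w)
    · calc 2 * d + 1 = #((univ : Finset (Fin (2 * d + 1))).map
            (.inr : _ ↪ Fin (2 * d + 1) ⊕ Fin (2 * d + 1))) := by simp
        _ ≤ _ := card_le_card fun x hx => by
          obtain ⟨y, -, rfl⟩ := mem_map.1 hx
          simp
    · calc 2 * d + 1 = #((univ : Finset (Fin (2 * d + 1))).map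
            (.inl : _ ↪ Fin (2 * d + 1) ⊕ Fin (2 * d + 1))) := by simp
        _ ≤ _ := card_le_card fun x hx => by
          obtain ⟨y, -, rfl⟩ := mem_map.1 hx
          simp
  have h3 := card_nsmul_le_sum univ _ _ (fun w _ => h2 w)
  rw [smul_eq_mul, card_univ] at h3
  have h4 := h3.trans h1
  simp only [Fintype.card_sum, Fintype.card_fin] at h4
  nlinarith

/-! ### Small hitting sets from sparse shallow minors. -/

section Hitting

variable {V : Type u} {G : SimpleGraph V} {S : Finset V} {r d : ℕ}

/-- A family of connectors between ordered pairs of vertices of `S`: the connector of `(v, w)` is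
the set of inner vertices of a walk of length at most `2 * r + 1` from `v` to `w`. Connectors
avoid `S` and are pairwise disjoint. -/
structure IsConnectorFamily (G : SimpleGraph V) (S : Finset V) (r : ℕ) (A : Finset (V × V))
    (Q : V × V → Finset V) : Prop where
  fst_mem : ∀ a ∈ A, a.1 ∈ S
  snd_mem : ∀ a ∈ A, a.2 ∈ S
  ne : ∀ a ∈ A, a.1 ≠ a.2
  notMem : ∀ a ∈ A, ∀ x ∈ Q a, x ∉ S
  disjoint : ∀ a ∈ A, ∀ b ∈ A, a ≠ b → Disjoint (Q a) (Q b)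
  exists_walk : ∀ a ∈ A, ∃ (y : V) (q : G.Walk a.1 y), q.length ≤ 2 * r ∧
    (∀ z, z ∈ q.support ↔ z = a.1 ∨ z ∈ Q a) ∧ G.Adj y a.2

theorem IsConnectorFamily.insert {A : Finset (V × V)} {Q : V × V → Finset V}
    (h : IsConnectorFamily G S r A Q) {v w y : V} (hv : v ∈ S) (hw : w ∈ S) (hvw : v ≠ w)
    (hA : (v, w) ∉ A) (q : G.Walk v y) (hq : q.length ≤ 2 * r)
    (hD : ∀ z ∈ q.support, z ∈ S ∪ A.biUnion Q → z = v) (hy : G.Adj y w) :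
    IsConnectorFamily G S r (insert (v, w) A)
      (Function.update Q (v, w) (q.support.toFinset.erase v)) := by
  have hne : ∀ a ∈ A, a ≠ (v, w) := fun a ha h => hA (h ▸ ha)
  have hdis : ∀ a ∈ A, Disjoint (q.support.toFinset.erase v) (Q a) := by
    intro a ha
    rw [disjoint_left]
    intro x hx hxa
    rw [mem_erase, List.mem_toFinset] at hx
    exact hx.1 (hD x hx.2 (mem_union_right _ (mem_biUnion.2 ⟨a, ha, hxa⟩)))
  constructor
  · intro a ha
    rcases mem_insert.1 ha with rfl | ha
    exacts [hv, h.fst_mem a ha]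
  · intro a ha
    rcases mem_insert.1 ha with rfl | ha
    exacts [hw, h.snd_mem a ha]
  · intro a ha
    rcases mem_insert.1 ha with rfl | ha
    exacts [hvw, h.ne a ha]
  · intro a ha x hx
    rcases mem_insert.1 ha with rfl | ha
    · rw [Function.update_self, mem_erase, List.mem_toFinset] at hx
      exact fun hxS => hx.1 (hD x hx.2 (mem_union_left _ hxS))
    · rw [Function.update_of_ne (hne a ha)] at hx
      exact h.notMem a ha x hx
  · intro a ha b hb hab
    rcases mem_insert.1 ha with rfl | ha <;> rcases mem_insert.1 hb with rfl | hb
    · exact absurd rfl hab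
    · rw [Function.update_self, Function.update_of_ne (hne b hb)]
      exact hdis b hb
    · rw [Function.update_self, Function.update_of_ne (hne a ha)]
      exact (hdis a ha).symm
    · rw [Function.update_of_ne (hne a ha), Function.update_of_ne (hne b hb)]
      exact h.disjoint a ha b hb hab
  · intro a ha
    rcases mem_insert.1 ha with rfl | ha
    · refine ⟨y, q, hq, fun z => ?_, hy⟩
      rw [Function.update_self, mem_erase, List.mem_toFinset]
      constructor
      · intro hz
        by_cases hzv : z = v
        exacts [.inl hzv, .inr ⟨hzv, hz⟩]
      · rintro (rfl | hz)
        exacts [q.start_mem_support, hz.2]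
    · rw [Function.update_of_ne (hne a ha)]
      exact h.exists_walk a ha

theorem IsConnectorFamily.card_le {A : Finset (V × V)} {Q : V × V → Finset V}
    (h : IsConnectorFamily G S r A Q) : ∀ a ∈ A, #(Q a) ≤ 2 * r + 1 := by
  intro a ha
  obtain ⟨y, q, hq, hQ, -⟩ := h.exists_walk a ha
  calc #(Q a) ≤ #q.support.toFinset := card_le_card fun z hz => by
        rw [List.mem_toFinset, hQ]
        exact .inr hz
    _ ≤ q.support.length := List.toFinset_card_le _
    _ ≤ 2 * r + 1 := by rw [SimpleGraph.Walk.length_support]; omega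

/-- The graph on `S` of the pairs that are joined by a connector. -/
def connectorGraph (S : Finset V) (A : Finset (V × V)) : SimpleGraph S where
  Adj x y := x ≠ y ∧ (((x : V), (y : V)) ∈ A ∨ ((y : V), (x : V)) ∈ A)
  symm := ⟨fun _ _ h => ⟨h.1.symm, h.2.symm⟩⟩
  loopless := ⟨fun _ h => h.1 rfl⟩

/-- Each vertex of `S` absorbs the connectors that start at it. They are walks of length at most `2
* r` from it, which gives the radius; disjointness of connectors gives disjoint branch sets. -/
theorem IsConnectorFamily.isShallowMinor {A : Finset (V × V)} {Q : V × V → Finset V}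
    (h : IsConnectorFamily G S r A Q) : IsShallowMinor (2 * r) (connectorGraph S A) G := by
  have hedge : ∀ x y : S, ((x : V), (y : V)) ∈ A →
      ∃ z, (z = (x : V) ∨ ∃ a ∈ A, a.1 = x ∧ z ∈ Q a) ∧ G.Adj z y := by
    intro x y hxy
    obtain ⟨z, q, -, hQ, hz⟩ := h.exists_walk _ hxy
    refine ⟨z, ?_, hz⟩
    rcases (hQ z).1 q.end_mem_support with hzx | hzQ
    exacts [.inl hzx, .inr ⟨_, hxy, rfl, hzQ⟩]
  refine ⟨fun x => {z | z = x ∨ ∃ a ∈ A, a.1 = x ∧ z ∈ Q a}, ?_, ?_, ?_⟩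
  · intro x y hxy
    rw [Set.disjoint_left]
    rintro z (hzx | ⟨a, ha, hax, hza⟩) (hzy | ⟨b, hb, hby, hzb⟩)
    · exact hxy (Subtype.ext (hzx.symm.trans hzy))
    · exact h.notMem b hb z hzb (hzx ▸ x.2)
    · exact h.notMem a ha z hza (hzy ▸ y.2)
    · refine disjoint_left.1 (h.disjoint a ha b hb ?_) hza hzb
      rintro rfl
      exact hxy (Subtype.ext (hax.symm.trans hby))
  · intro x
    refine ⟨⟨x, .inl rfl⟩, ?_⟩
    rintro ⟨z, hz⟩
    rcases id hz with rfl | ⟨⟨a, b⟩, ha, hax, hza⟩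
    · exact ⟨.nil, by simp⟩
    · obtain ⟨y, q, hq, hQ, -⟩ := h.exists_walk _ ha
      dsimp only at hax
      subst hax
      have hzq : z ∈ q.support := (hQ z).2 (.inr hza)
      refine exists_induce_walk _ _ (q.takeUntil z hzq) ?_
        ((q.length_takeUntil_le_length hzq).trans hq)
      intro u hu
      rcases (hQ u).1 (q.support_takeUntil_subset_support hzq hu) with hu | hu
      exacts [.inl hu, .inr ⟨_, ha, rfl, hu⟩]
  · rintro x y ⟨-, hxy | hxy⟩
    · obtain ⟨z, hz, hzy⟩ := hedge x y hxy
      exact ⟨z, hz, y, .inl rfl, hzy⟩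
    · obtain ⟨z, hz, hzy⟩ := hedge y x hxy
      exact ⟨x, .inl rfl, z, hz, hzy.symm⟩

theorem IsConnectorFamily.card_le_sum {A : Finset (V × V)} {Q : V × V → Finset V}
    (h : IsConnectorFamily G S r A Q) :
    #A ≤ ∑ x, #{y | (connectorGraph S A).Adj x y} := by
  have hsub : A ⊆ (univ : Finset S).biUnion fun x =>
      ({y | (connectorGraph S A).Adj x y} : Finset S).image
        fun y : S => ((x : V), (y : V)) := by
    intro a ha
    refine mem_biUnion.2 ⟨⟨a.1, h.fst_mem a ha⟩, mem_univ _,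
      mem_image.2 ⟨⟨a.2, h.snd_mem a ha⟩, ?_, rfl⟩⟩
    exact mem_filter.2 ⟨mem_univ _, fun he => h.ne a ha (congrArg Subtype.val he), .inl ha⟩
  exact (card_le_card hsub).trans (card_biUnion_le.trans (sum_le_sum fun x _ => card_image_le))

/-- The vertices reachable from `v` within distance `r` while avoiding `D`. -/
def avoidingBall (G : SimpleGraph V) (D : Finset V) (r : ℕ) (v : V) : Set V :=
  {x | ∃ q : G.Walk v x, q.length ≤ r ∧ ∀ z ∈ q.support, z ∈ D → z = v}

/-- The vertices of `D` that are adjacent to the ball around `v` avoiding `D`. -/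
noncomputable def entrySet (G : SimpleGraph V) (D : Finset V) (r : ℕ) (v : V) : Finset V :=
  {y ∈ D | y ≠ v ∧ ∃ x ∈ avoidingBall G D r v, G.Adj x y}

theorem mem_entrySet {D : Finset V} {v y : V} : y ∈ entrySet G D r v ↔
    y ∈ D ∧ y ≠ v ∧ ∃ x ∈ avoidingBall G D r v, G.Adj x y := by
  rw [entrySet, mem_filter]

/-- The entry set hits all short walks to `D`. -/
theorem exists_mem_entrySet {D : Finset V} {v u : V} (hu : u ∈ D) (huv : u ≠ v) (p : G.Walk v u)
    (hp : p.length ≤ r) : ∃ x ∈ entrySet G D r v, x ∈ p.support := by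
  obtain ⟨y, hy, ⟨hyD, hyv⟩, x, q, hq, hqD, hxy⟩ := exists_first_entry (D := {y | y ∈ D ∧ y ≠ v}) p
    (fun h => h.2 rfl) ⟨hu, huv⟩
  refine ⟨y, mem_entrySet.2 ⟨hyD, hyv, x, ⟨q, by omega, fun z hz hzD => ?_⟩, hxy⟩, hy⟩
  by_contra hzv
  exact (hqD z hz).2 ⟨hzD, hzv⟩

/-- The graph on `D` joining the vertices of `R` to their entry sets. -/
def entryGraph (G : SimpleGraph V) (D R : Finset V) (r : ℕ) : SimpleGraph D where
  Adj x y := x ≠ y ∧ (((x : V) ∈ R ∧ (y : V) ∈ entrySet G D r x) ∨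
    ((y : V) ∈ R ∧ (x : V) ∈ entrySet G D r y))
  symm := ⟨fun _ _ h => ⟨h.1.symm, h.2.symm⟩⟩
  loopless := ⟨fun _ h => h.1 rfl⟩

/-- Each vertex of `R` absorbs its ball, which meets `D` only in its centre; the other vertices of
`D` stay singletons. Radius `r` would do, but `2 * r` matches the density bound used for connectors.
-/
theorem entryGraph_isShallowMinor {D R : Finset V}
    (hR : ∀ x ∈ R, ∀ y ∈ R, x ≠ y →
      Disjoint (avoidingBall G D r x) (avoidingBall G D r y)) :
    IsShallowMinor (2 * r) (entryGraph G D R r) G := by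
  have hball : ∀ x z, z ∈ D → z ∈ avoidingBall G D r x → z = x := by
    rintro x z hz ⟨q, -, hq⟩
    exact hq z q.end_mem_support hz
  refine ⟨fun x => {z | z = x ∨ ((x : V) ∈ R ∧ z ∈ avoidingBall G D r x)}, ?_, ?_, ?_⟩
  · intro x y hxy
    rw [Set.disjoint_left]
    rintro z (hzx | ⟨hxR, hzx⟩) (hzy | ⟨hyR, hzy⟩)
    · exact hxy (Subtype.ext (hzx.symm.trans hzy))
    · subst hzx
      exact hxy (Subtype.ext (hball _ _ x.2 hzy))
    · subst hzy
      exact hxy (Subtype.ext (hball _ _ y.2 hzx).symm)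
    · exact Set.disjoint_left.1 (hR x hxR y hyR fun h => hxy (Subtype.ext h)) hzx hzy
  · intro x
    refine ⟨⟨x, .inl rfl⟩, ?_⟩
    rintro ⟨z, hz⟩
    rcases id hz with rfl | ⟨hxR, q, hq, hqD⟩
    · exact ⟨.nil, by simp⟩
    · refine exists_induce_walk _ _ q ?_ (by omega)
      intro u hu
      refine .inr ⟨hxR, q.takeUntil u hu, (q.length_takeUntil_le_length hu).trans hq,
        fun z' hz' => hqD z' (q.support_takeUntil_subset_support hu hz')⟩
  · have hedge : ∀ x y : D, (x : V) ∈ R → (y : V) ∈ entrySet G D r x →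
        ∃ z, (z = (x : V) ∨ ((x : V) ∈ R ∧ z ∈ avoidingBall G D r x)) ∧ G.Adj z y := by
      intro x y hx hy
      obtain ⟨-, -, z, hz, hzy⟩ := mem_entrySet.1 hy
      exact ⟨z, .inr ⟨hx, hz⟩, hzy⟩
    rintro x y ⟨-, ⟨hx, hy⟩ | ⟨hy, hx⟩⟩
    · obtain ⟨z, hz, hzy⟩ := hedge x y hx hy
      exact ⟨z, hz, y, .inl rfl, hzy⟩
    · obtain ⟨z, hz, hzy⟩ := hedge y x hy hx
      exact ⟨x, .inl rfl, z, hz, hzy.symm⟩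

theorem card_mul_le_sum_entryGraph {D R : Finset V} (hRD : R ⊆ D) {K : ℕ}
    (hK : ∀ v ∈ R, K ≤ #(entrySet G D r v)) :
    #R * K ≤ ∑ x, #{y | (entryGraph G D R r).Adj x y} := by
  have h1 : ∀ x ∈ ({x | (x : V) ∈ R} : Finset D), K ≤ #{y | (entryGraph G D R r).Adj x y} := by
    intro x hx
    have hxR := (mem_filter.1 hx).2
    refine (hK x hxR).trans ?_
    have hsub : entrySet G D r x ⊆
        ({y | (entryGraph G D R r).Adj x y} : Finset D).image Subtype.val := by
      intro y hy
      obtain ⟨hyD, hyx, -⟩ := mem_entrySet.1 hy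
      exact mem_image.2 ⟨⟨y, hyD⟩, mem_filter.2 ⟨mem_univ _,
        fun h => hyx (congrArg Subtype.val h).symm, .inl ⟨hxR, hy⟩⟩, rfl⟩
    exact (card_le_card hsub).trans card_image_le
  have h2 : #R ≤ #({x | (x : V) ∈ R} : Finset D) := by
    have hsub : R ⊆ ({x | (x : V) ∈ R} : Finset D).image Subtype.val := fun x hx =>
      mem_image.2 ⟨⟨x, hRD hx⟩, mem_filter.2 ⟨mem_univ _, hx⟩, rfl⟩
    exact (card_le_card hsub).trans card_image_le
  calc #R * K ≤ #({x | (x : V) ∈ R} : Finset D) * K := Nat.mul_le_mul_right _ h2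
    _ ≤ ∑ x ∈ ({x | (x : V) ∈ R} : Finset D), #{y | (entryGraph G D R r).Adj x y} := by
        simpa using card_nsmul_le_sum _ _ _ h1
    _ ≤ _ := sum_le_sum_of_subset (subset_univ _)

/-- If the shallow minors of `G` are sparse, every nonempty set `S` contains a vertex from which
all short walks to other vertices of `S` are hit by a small set. -/
theorem exists_hitting_set [Finite V]
    (hd : ∀ (n : ℕ) (H : SimpleGraph (Fin n)), IsShallowMinor (2 * r) H G →
      H.edgeSet.ncard ≤ d * n) (hS : S.Nonempty) :
    ∃ v ∈ S, ∃ X : Finset V, #X ≤ 2 * d * (1 + 2 * d * (2 * r + 1)) * (2 * (4 * d + 1)) ∧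
      v ∉ X ∧ ∀ u ∈ S, u ≠ v → ∀ p : G.Walk v u, p.length ≤ r → ∃ x ∈ X, x ∈ p.support := by
  have := Fintype.ofFinite V
  -- A maximal family of connectors: any walk that could serve as a new one belongs to a pair
  -- already in `A`.
  obtain ⟨A, hA⟩ := Set.Finite.exists_maximal
    (s := {A : Finset (V × V) | ∃ Q, IsConnectorFamily G S r A Q}) (Set.toFinite _)
    ⟨∅, fun _ => ∅, by constructor <;> simp⟩
  obtain ⟨Q, hQ⟩ := hA.1
  set D : Finset V := S ∪ A.biUnion Q with hD
  have hmax : ∀ v ∈ S, ∀ w ∈ S, v ≠ w → ∀ y (q : G.Walk v y), q.length ≤ 2 * r →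
      (∀ z ∈ q.support, z ∈ D → z = v) → G.Adj y w → (v, w) ∈ A := by
    intro v hv w hw hvw y q hq hqD hyw
    by_contra hcon
    exact hcon (hA.2 ⟨_, hQ.insert hv hw hvw hcon q hq hqD hyw⟩ (subset_insert _ _)
      (mem_insert_self _ _))
  have hsum := sum_degree_le hd _ hQ.isShallowMinor
  obtain ⟨R, hRcard, hR⟩ := exists_indep _ d hsum
  have hAcard := hQ.card_le_sum.trans hsum
  rw [Fintype.card_coe] at hRcard hAcard
  set R' : Finset V := R.map (.subtype _) with hR'
  have hR'card : #R' = #R := card_map _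
  have hR'S : ∀ x ∈ R', ∃ h : x ∈ S, ⟨x, h⟩ ∈ R := by
    intro x hx
    obtain ⟨y, hy, rfl⟩ := mem_map.1 hx
    exact ⟨y.2, hy⟩
  have hdisj : ∀ x ∈ R', ∀ y ∈ R', x ≠ y →
      Disjoint (avoidingBall G D r x) (avoidingBall G D r y) := by
    intro x hx y hy hxy
    obtain ⟨hxS, hxR⟩ := hR'S x hx
    obtain ⟨hyS, hyR⟩ := hR'S y hy
    rw [Set.disjoint_left]
    rintro z ⟨q₁, hl₁, hq₁⟩ ⟨q₂, hl₂, hq₂⟩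
    -- If two balls met, joining their walks and stopping before the first visit to `y` would give a
    -- connector, so the pair would lie in `A`, against the independence of `R`.
    obtain ⟨_, -, rfl, x', q, hl, hq, hadj⟩ := exists_first_entry (D := {y})
      (q₁.append q₂.reverse) hxy rfl
    refine hR _ hxR _ hyR ⟨fun h => hxy (congrArg Subtype.val h), .inl ?_⟩
    refine hmax x hxS _ hyS hxy x' q ?_ ?_ hadj
    · rw [SimpleGraph.Walk.length_append, SimpleGraph.Walk.length_reverse] at hl
      omega
    · intro u hu huD
      obtain ⟨h1, h2⟩ := hq u hu
      rw [SimpleGraph.Walk.mem_support_append_iff, SimpleGraph.Walk.support_reverse,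
        List.mem_reverse] at h1
      rcases h1 with h1 | h1
      · exact hq₁ u h1 huD
      · exact absurd (hq₂ u h1 huD) h2
  by_contra! hcon
  have hlarge : ∀ v ∈ S, 2 * d * (1 + 2 * d * (2 * r + 1)) * (2 * (4 * d + 1)) + 1 ≤
      #(entrySet G D r v) := by
    intro v hv
    by_contra hlt
    obtain ⟨u, hu, huv, p, hp, hpX⟩ := hcon v hv (entrySet G D r v) (by omega)
      (fun h => (mem_entrySet.1 h).2.1 rfl)
    obtain ⟨x, hx, hxp⟩ := exists_mem_entrySet (D := D) (mem_union_left _ hu) huv p hp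
    exact hpX x hx hxp
  have h1 := (card_mul_le_sum_entryGraph (G := G) (r := r) (D := D) (R := R')
    (fun x hx => mem_union_left _ (hR'S x hx).1) (fun v hv => hlarge v (hR'S v hv).1)).trans
    (sum_degree_le hd _ (entryGraph_isShallowMinor hdisj))
  rw [Fintype.card_coe, hR'card] at h1
  have hDcard : #D ≤ #S + 2 * (d * #S) * (2 * r + 1) :=
    (card_union_le _ _).trans (Nat.add_le_add_left
      ((card_biUnion_le_card_mul _ _ _ hQ.card_le).trans (Nat.mul_le_mul_right _ hAcard)) _)
  have hSpos : 0 < #S := card_pos.2 hS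
  have hRpos : 0 < #R := by
    rcases Nat.eq_zero_or_pos #R with h | h
    · rw [h] at hRcard
      omega
    · exact h
  -- Both `#D` and `#R` are comparable to `#S`, so entry sets larger than the bound at all vertices
  -- of `R` would make the entry graph too dense; the `+ 1` in `hlarge` and `R` being nonempty make
  -- this strict.
  have h2 : 2 * (d * #D) ≤ #R * (2 * d * (1 + 2 * d * (2 * r + 1)) * (2 * (4 * d + 1))) :=
    calc 2 * (d * #D) ≤ 2 * (d * (#S + 2 * (d * #S) * (2 * r + 1))) := by gcongr
      _ = 2 * d * (1 + 2 * d * (2 * r + 1)) * #S := by ring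
      _ ≤ 2 * d * (1 + 2 * d * (2 * r + 1)) * (2 * ((4 * d + 1) * #R)) := by gcongr
      _ = _ := by ring
  have h3 := h1.trans h2
  rw [Nat.mul_add, mul_one] at h3
  omega

end Hitting

/-! ### The flip sequence of a vertex ordering. -/

section Order

variable {V : Type u} {G : SimpleGraph V} {rank : V → ℕ} {r K : ℕ}

/-- The vertices of rank less than `t` that are reachable from `x` by a walk of length at most `l`
whose other vertices have rank at least `t`. -/
noncomputable def reachBelow [Fintype V] (G : SimpleGraph V) (rank : V → ℕ) (t l : ℕ) (x : V) :
    Finset V :=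
  {u | rank u < t ∧ ∃ p : G.Walk x u, p.length ≤ l ∧ ∀ z ∈ p.support, z ≠ u → t ≤ rank z}

/-- The bound on the number of vertices reachable below a threshold. -/
def reachBound (K : ℕ) : ℕ → ℕ
  | 0 => 0
  | l + 1 => K + K * reachBound K l

/-- The hitting set of `x` meets each walk counted here either in its end `u`, or in a vertex of
rank at least `t` other than `x`, from which a strictly shorter walk of the same kind leads to `u`.
-/
theorem card_reachBelow_le [Fintype V]
    (hit : ∀ v, ∃ X : Finset V, #X ≤ K ∧ v ∉ X ∧ ∀ u, rank u < rank v →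
      ∀ p : G.Walk v u, p.length ≤ r → ∃ x ∈ X, x ∈ p.support)
    (t l : ℕ) (hl : l ≤ r) (x : V) (hx : t ≤ rank x) :
    #(reachBelow G rank t l x) ≤ reachBound K l := by
  induction l generalizing x with
  | zero =>
    rw [reachBound, Nat.le_zero, card_eq_zero, eq_empty_iff_forall_notMem]
    intro u hu
    obtain ⟨-, hut, p, hp, -⟩ := mem_filter.1 hu
    have := SimpleGraph.Walk.eq_of_length_eq_zero (Nat.le_zero.1 hp)
    subst this
    omega
  | succ l ih =>
    obtain ⟨X, hX, hxX, hhit⟩ := hit x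
    have hsub : reachBelow G rank t (l + 1) x ⊆
        X ∪ ({z ∈ X | t ≤ rank z}).biUnion (reachBelow G rank t l) := by
      intro u hu
      obtain ⟨-, hut, p, hp, hpt⟩ := mem_filter.1 hu
      obtain ⟨z, hzX, hzp⟩ := hhit u (by omega) p (by omega)
      by_cases hzu : z = u
      · exact mem_union_left _ (hzu ▸ hzX)
      · have hzx : z ≠ x := fun h => hxX (h ▸ hzX)
        refine mem_union_right _ (mem_biUnion.2 ⟨z, mem_filter.2 ⟨hzX, hpt z hzp hzu⟩,
          mem_filter.2 ⟨mem_univ _, hut, p.dropUntil z hzp, ?_, fun y hy =>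
            hpt y (p.support_dropUntil_subset_support hzp hy)⟩⟩)
        have := p.length_dropUntil_lt_length hzp hzx
        omega
    refine (card_le_card hsub).trans ((card_union_le _ _).trans (Nat.add_le_add hX ?_))
    refine (card_biUnion_le_card_mul _ _ (reachBound K l) fun z hz =>
      ih (by omega) z (mem_filter.1 hz).2).trans (Nat.mul_le_mul_right _ ?_)
    exact (card_filter_le _ _).trans hX

/-- The partition into the singletons of rank less than `i`, and the classes of the other vertices
according to their neighbourhoods in the set of vertices of rank less than `i`. -/
def orderSetoid (G : SimpleGraph V) (rank : V → ℕ) (i : ℕ) : Setoid V where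
  r u v := u = v ∨ (i ≤ rank u ∧ i ≤ rank v ∧ ∀ w, rank w < i → (G.Adj u w ↔ G.Adj v w))
  iseqv := by
    refine ⟨fun u => .inl rfl, ?_, ?_⟩
    · rintro u v (rfl | ⟨h1, h2, h3⟩)
      · exact .inl rfl
      · exact .inr ⟨h2, h1, fun w hw => (h3 w hw).symm⟩
    · rintro u v w (rfl | ⟨h1, h2, h3⟩) (rfl | ⟨h4, h5, h6⟩)
      · exact .inl rfl
      · exact .inr ⟨h4, h5, h6⟩
      · exact .inr ⟨h1, h2, h3⟩
      · exact .inr ⟨h1, h5, fun x hx => (h3 x hx).trans (h6 x hx)⟩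

/-- The subgraph of the edges between vertices of rank at least `i`. -/
def tailGraph (G : SimpleGraph V) (rank : V → ℕ) (i : ℕ) : SimpleGraph V where
  Adj u v := G.Adj u v ∧ i ≤ rank u ∧ i ≤ rank v
  symm := ⟨fun _ _ h => ⟨h.1.symm, h.2.2, h.2.1⟩⟩
  loopless := ⟨fun _ h => G.irrefl h.1⟩

/-- A vertex of rank less than `i` is a part of its own and is adjacent to all or none of any other
part, so the edges at such vertices can be flipped away exactly. -/
theorem isFlip_tailGraph (G : SimpleGraph V) (rank : V → ℕ) (i : ℕ) :
    IsFlip (orderSetoid G rank i) G (tailGraph G rank i) := by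
  have hstep : ∀ u v u' v', orderSetoid G rank i u u' → orderSetoid G rank i v v' →
      G.Adj u' v' → rank u' < i → G.Adj u v ∧ rank u < i := by
    rintro u v u' v' (rfl | ⟨-, h, -⟩) hv hadj hlt
    · refine ⟨?_, hlt⟩
      rcases hv with rfl | ⟨-, -, h⟩
      · exact hadj
      · exact ((h u hlt).2 hadj.symm).symm
    · omega
  refine ⟨{q | ∃ u v, q = s(Quotient.mk _ u, Quotient.mk _ v) ∧ G.Adj u v ∧ rank u < i}, ?_⟩
  intro u v huv
  have key : s(Quotient.mk (orderSetoid G rank i) u, Quotient.mk (orderSetoid G rank i) v) ∈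
      {q | ∃ u v, q = s(Quotient.mk (orderSetoid G rank i) u, Quotient.mk _ v) ∧
        G.Adj u v ∧ rank u < i} ↔ G.Adj u v ∧ (rank u < i ∨ rank v < i) := by
    constructor
    · rintro ⟨u', v', heq, hadj, hlt⟩
      rw [Sym2.eq_iff] at heq
      rcases heq with ⟨h1, h2⟩ | ⟨h1, h2⟩
      · obtain ⟨h3, h4⟩ := hstep u v u' v' (Quotient.exact h1) (Quotient.exact h2) hadj hlt
        exact ⟨h3, .inl h4⟩
      · obtain ⟨h3, h4⟩ := hstep v u u' v' (Quotient.exact h2) (Quotient.exact h1) hadj hlt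
        exact ⟨h3.symm, .inr h4⟩
    · rintro ⟨hadj, hlt | hlt⟩
      · exact ⟨u, v, rfl, hadj, hlt⟩
      · exact ⟨v, u, Sym2.eq_swap, hadj.symm, hlt⟩
  rw [key]
  simp only [tailGraph, Xor, ← not_lt]
  tauto

/-- The restrained flip sequence isolating the vertices one by one. -/
noncomputable def orderFlipSeq (G : SimpleGraph V) (rank : V → ℕ) (n : ℕ)
    (hlt : ∀ v, rank v < n) : RestrainedFlipSeq G where
  m := n
  P i := orderSetoid G rank i
  -- `tailGraph` at 0 is `G` itself, whereas the first set of pairs has to be complete.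
  R i := if (i : ℕ) = 0 then ⊤ else tailGraph G rank i
  flip i := tailGraph G rank i
  P_antitone := by
    rintro i j hij u v (rfl | ⟨h1, h2, h3⟩)
    · exact .inl rfl
    · exact .inr ⟨le_trans hij h1, le_trans hij h2, fun w hw => h3 w (lt_of_lt_of_le hw hij)⟩
  P_zero := by
    rw [eq_top_iff]
    intro u v _
    exact .inr ⟨by simp, by simp, by simp⟩
  P_last := by
    rw [eq_bot_iff]
    rintro u v (rfl | ⟨h, -, -⟩)
    · rfl
    · exact absurd (hlt u) (not_lt.2 h)
  isFlip i := isFlip_tailGraph G rank i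
  R_antitone := by
    intro i j hij
    by_cases hi : (i : ℕ) = 0
    · simp [hi]
    · have hij' : (i : ℕ) ≤ j := hij
      have hj : (j : ℕ) ≠ 0 := by omega
      simp only [hi, hj, if_false]
      exact fun u v h => ⟨h.1, hij'.trans h.2.1, hij'.trans h.2.2⟩
  R_zero := by simp
  R_last := by
    rw [eq_bot_iff]
    intro u v h
    have hu := hlt u
    simp only [Fin.val_last] at h
    rw [if_neg (by omega)] at h
    exact absurd hu (not_lt.2 h.2.1)
  flip_le i := by
    split_ifs
    · exact le_top
    · exact le_rfl

/-- A part of vertices of rank at least `i` is determined by its common neighbourhood below `i`,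
here a subset of `Z`. -/
theorem encard_parts_le [Fintype V] {i : ℕ} (𝒜 : Set (Quotient (orderSetoid G rank i)))
    (Y Z : Finset V) (h : ∀ A ∈ 𝒜, ∃ u, Quotient.mk _ u = A ∧
      (u ∈ Y ∨ (i ≤ rank u ∧ ∀ z, rank z < i → G.Adj u z → z ∈ Z))) :
    𝒜.encard ≤ (#Y + 2 ^ #Z : ℕ) := by
  have hsub : 𝒜 ⊆ (Y.image (Quotient.mk _) ∪ Z.powerset.biUnion (fun s =>
      {A | ∃ u, Quotient.mk _ u = A ∧ i ≤ rank u ∧ ∀ z, rank z < i → (G.Adj u z ↔ z ∈ s)}) :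
      Finset (Quotient (orderSetoid G rank i))) := by
    intro A hA
    obtain ⟨u, rfl, hu | ⟨hi, hu⟩⟩ := h A hA
    · exact mem_coe.2 (mem_union_left _ (mem_image_of_mem _ hu))
    · refine mem_coe.2 (mem_union_right _ (mem_biUnion.2
        ⟨{z ∈ Z | rank z < i ∧ G.Adj u z}, mem_powerset.2 (filter_subset _ _),
          mem_filter.2 ⟨mem_univ _, u, rfl, hi, fun z hz => ?_⟩⟩))
      rw [mem_filter]
      exact ⟨fun hz' => ⟨hu z hz hz', hz, hz'⟩, fun hz' => hz'.2.2⟩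
  refine (Set.encard_le_encard hsub).trans ?_
  rw [Set.encard_coe_eq_coe_finsetCard, Nat.cast_le]
  refine (card_union_le _ _).trans (Nat.add_le_add card_image_le ?_)
  refine (card_biUnion_le_card_mul _ _ 1 fun s _ => ?_).trans (by rw [card_powerset, mul_one])
  refine card_le_one.2 fun A hA B hB => ?_
  obtain ⟨-, u, rfl, hu, hu'⟩ := mem_filter.1 hA
  obtain ⟨-, v, rfl, hv, hv'⟩ := mem_filter.1 hB
  exact Quotient.sound (.inr ⟨hu, hv, fun w hw => (hu' w hw).trans (hv' w hw).symm⟩)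

theorem exists_walk_of_tailGraph {i : ℕ} {v u : V} (p : (tailGraph G rank i).Walk v u)
    (hv : i ≤ rank v) :
    ∃ q : G.Walk v u, q.length = p.length ∧ ∀ z ∈ q.support, i ≤ rank z := by
  induction p with
  | nil => exact ⟨.nil, rfl, by simpa using hv⟩
  | @cons a b c h p ih =>
    obtain ⟨q, hl, hq⟩ := ih h.2.2
    exact ⟨.cons h.1 q, by simp [hl], by simpa using ⟨hv, hq⟩⟩

/-- The width of the flip sequence of an ordering with small hitting sets. -/
theorem orderFlipSeq_width_le [Fintype V] (hinj : Function.Injective rank)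
    (hit : ∀ v, ∃ X : Finset V, #X ≤ K ∧ v ∉ X ∧ ∀ u, rank u < rank v →
      ∀ p : G.Walk v u, p.length ≤ r + 1 → ∃ x ∈ X, x ∈ p.support)
    (n : ℕ) (hlt : ∀ v, rank v < n) :
    (orderFlipSeq G rank n hlt).width r ≤ (2 + 2 ^ (reachBound K (r + 1) + 1) : ℕ) := by
  refine iSup_le fun i => iSup_le fun v => ?_
  have hone : ∀ j, #({z | rank z = j} : Finset V) ≤ 1 := fun j =>
    card_le_one.2 fun a ha b hb =>
      hinj ((mem_filter.1 ha).2.trans (mem_filter.1 hb).2.symm)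
  change (reachableParts r (orderSetoid G rank (i.succ : Fin (n + 1)))
    (if ((i.castSucc : Fin (n + 1)) : ℕ) = 0 then ⊤ else
      tailGraph G rank (i.castSucc : Fin (n + 1))) v).encard ≤ _
  rw [Fin.val_succ, Fin.val_castSucc]
  generalize (i : ℕ) = j
  rcases lt_or_ge (rank v) j with hv | hv
  -- A vertex of rank less than `j` is isolated in `R`, so it reaches only its own part.
  · refine (encard_parts_le _ {v} ∅ ?_).trans ?_
    · rintro A ⟨u, rfl, p, -, -⟩
      refine ⟨u, rfl, .inl ?_⟩
      rw [if_neg (by omega)] at p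
      cases p with
      | nil => simp
      | cons h p => exact absurd hv (not_lt.2 h.2.1)
    · rw [Nat.cast_le, card_singleton, card_empty, pow_zero]
      have := Nat.two_pow_pos (reachBound K (r + 1) + 1)
      omega
  · refine (encard_parts_le _ ({z | rank z = j} : Finset V)
      (reachBelow G rank j (r + 1) v ∪ ({z | rank z = j} : Finset V)) ?_).trans ?_
    · rintro A ⟨u, rfl, hex⟩
      refine ⟨u, rfl, ?_⟩
      by_cases huj : rank u = j
      · exact .inl (mem_filter.2 ⟨mem_univ _, huj⟩)
      right
      -- For `j = 0` every vertex is reachable, but neighbourhoods are taken only in the vertex of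
      -- rank 0.
      rcases Nat.eq_zero_or_pos j with rfl | hj
      · exact ⟨by omega, fun z hz _ =>
          mem_union_right _ (mem_filter.2 ⟨mem_univ _, by omega⟩)⟩
      · rw [if_neg (by omega)] at hex
        obtain ⟨q, -, hq⟩ := hex
        obtain ⟨q', hl, hq'⟩ := exists_walk_of_tailGraph q hv
        have hu := hq' u q'.end_mem_support
        refine ⟨by omega, fun z hz huz => ?_⟩
        by_cases hzj : rank z = j
        · exact mem_union_right _ (mem_filter.2 ⟨mem_univ _, hzj⟩)
        -- Appending the edge to `z` turns a walk of length at most `r` into one counted by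
        -- `reachBelow`; this is where radius `r + 1` comes from.
        · refine mem_union_left _ (mem_filter.2 ⟨mem_univ _, by omega, q'.concat huz, ?_, ?_⟩)
          · rw [SimpleGraph.Walk.length_concat]
            omega
          · intro y hy hyz
            rw [SimpleGraph.Walk.support_concat, List.mem_append, List.mem_singleton] at hy
            rcases hy with hy | hy
            exacts [hq' y hy, absurd hy hyz]
    · rw [Nat.cast_le]
      refine Nat.add_le_add ((hone j).trans one_le_two) (Nat.pow_le_pow_right two_pos ?_)
      exact (card_union_le _ _).trans
        (Nat.add_le_add (card_reachBelow_le hit j (r + 1) le_rfl v hv) (hone j))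

end Order

/-! ### Conclusion. -/

/-- A class of bounded expansion has bounded merge-width. -/
theorem BoundedExpansion.boundedMergeWidth {C : GraphClass.{u}} (hC : BoundedExpansion C) :
    BoundedMergeWidth C := by
  intro r
  obtain ⟨d, hd⟩ := hC (2 * (r + 1))
  set K := 2 * d * (1 + 2 * d * (2 * (r + 1) + 1)) * (2 * (4 * d + 1)) with hK
  refine lt_of_le_of_lt (b := ((2 + 2 ^ (reachBound K (r + 1) + 1) : ℕ) : ℕ∞)) ?_
    (ENat.natCast_lt_top _)
  refine iSup₂_le fun G hG => ?_
  have := G.finite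
  have := Fintype.ofFinite G.V
  obtain ⟨rank, hinj, hlt, hgood⟩ := exists_rank (fun (S : Finset G.V) v =>
    ∃ X : Finset G.V, #X ≤ K ∧ v ∉ X ∧ ∀ u ∈ S, u ≠ v → ∀ p : G.graph.Walk v u,
      p.length ≤ r + 1 → ∃ x ∈ X, x ∈ p.support) univ
    (fun S _ hS => exists_hitting_set (hd G hG) hS)
  refine (iInf_le _ (orderFlipSeq G.graph rank _ fun v => hlt v (mem_univ v))).trans
    (orderFlipSeq_width_le (fun a b hab => hinj (mem_univ a) (mem_univ b) hab) ?_ _ _)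
  intro v
  obtain ⟨X, h1, h2, h3⟩ := hgood v (mem_univ v)
  refine ⟨X, h1, h2, fun u hu p hp => h3 u (mem_filter.2 ⟨mem_univ _, hu.le⟩) ?_ p hp⟩
  rintro rfl
  exact lt_irrefl _ hu

end SparseGraphs

theorem theorem1p4 (C : GraphClass.{u}) :
    SparseGraphs.BoundedExpansion C ↔
      SparseGraphs.WeaklySparse C ∧ SparseGraphs.BoundedMergeWidth C :=
  ⟨fun h => ⟨h.weaklySparse, h.boundedMergeWidth⟩, fun h => h.1.boundedExpansion h.2⟩
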